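/- **Theorem (risk consistency).** For every $n\ge 1$ let $p=p_n\ge 2$ and let $(X_i,Y_i,S_i)$, $i=1,\dots,n$, be i.i.d. copies of a random triple $(X,Y,S)$ with values in $\mathbb R^{p}\times\{0,1\}\times\{0,1\}$; the law of the triple may depend on $n$. Put $\sigma(t)=1/(1+e^{-t})$ and $|a|_1=\sum_j|a_j|$. Assume the following. * Negative instances are never labelled, $P(S=1\mid X=x,Y=0)=0$, and for almost every $x$ $$P(Y=1\mid X=x)=\sigma(\beta_*^Tx),\qquad P(S=1\mid Y=1,X=x)=\sigma(\gamma_*^Tx),$$ for some $\theta_*=(\beta_*,\gamma_*)\in\mathbb R^p\times\mathbb R^p$ with $|\beta_*|_1>|\gamma_*|_1$; $\theta_*$ may depend on $n$, but $|\theta_*|_1=|\beta_*|_1+|\gamma_*|_1$ is bounded in $n$. * The matrix $\mathbb E XX^T$ is positive definite. * There is $\mu>0$, not depending on $n$, such that $\mathbb E\exp(tX_{ij})\le\exp(\mu^2t^2/2)$ for all $n$, all $i\le n$, $j\le p$ and $t\in\mathbb R$, where $X_{ij}$ is the $j$-th coordinate of $X_i$. For $\theta=(\beta,\gamma)\in\mathbb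 R^p\times\mathbb R^p$ define $$\phi(a,b,s)=-s\log[\sigma(a)\sigma(b)]-(1-s)\log[1-\sigma(a)\sigma(b)],$$ $$Q(\theta)=\mathbb E\,\phi(\beta^TX,\gamma^TX,S),\qquad Q_n(\theta)=\frac1n\sum_{i=1}^n\phi(\beta^TX_i,\gamma^TX_i,S_i),\qquad R(\theta)=Q(\theta)-Q(\theta_*).$$ Suppose $\log p=o(n)$ and let $w=C(n/\log p)^{1/2-\eta}$ with constants $C>0$ and $0<\eta<1/2$. Let $\tilde\theta=(\tilde\beta,\tilde\gamma)$ be any minimiser of $Q_n$ over $\{\theta:|\theta|_1\le w\}$. Then $R(\tilde\theta)\to0$ in probability as $n\to\infty$. The same holds after replacing $\tilde\theta$ by $(\tilde\gamma,\tilde\beta)$ whenever $|\tilde\beta|_1\le|\tilde\gamma|_1$. -/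

import Mathlib

open MeasureTheory ProbabilityTheory Filter Asymptotics
open scoped Topology NNReal

noncomputable section

namespace PULearning

/-- Sample space of one triple `(X, Y, S)`: feature vector, true class, label indicator
(`true` stands for `1`, `false` for `0`). -/
abbrev Obs (p : ℕ) : Type := (Fin p → ℝ) × Bool × Bool

/-- A joint parameter `θ = (β, γ)`. -/
abbrev Param (p : ℕ) : Type := (Fin p → ℝ) × (Fin p → ℝ)

/-- The feature vector `X` of a triple. -/
def Obs.feature {p : ℕ} (z : Obs p) : Fin p → ℝ := z.1

/-- The true class `Y` of a triple. -/
def Obs.trueClass {p : ℕ} (z : Obs p) : Bool := z.2.1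

/-- The label indicator `S` of a triple. -/
def Obs.label {p : ℕ} (z : Obs p) : Bool := z.2.2

/-- The `ℓ₁` norm of a vector. -/
def l1 {p : ℕ} (a : Fin p → ℝ) : ℝ := ∑ j, |a j|

/-- The `ℓ₁` norm of a joint parameter, as a vector of length `2p`. -/
def Param.l1 {p : ℕ} (θ : Param p) : ℝ := PULearning.l1 θ.1 + PULearning.l1 θ.2

/-- The closed `ℓ₁` ball of radius `w` around zero. -/
def l1Ball (p : ℕ) (w : ℝ) : Set (Param p) := {θ | Param.l1 θ ≤ w}

/-- The logistic loss `φ(a, b, s)` for the product of two logistic probabilities. -/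
def loss (a b : ℝ) (s : Bool) : ℝ :=
  -(s.toNat : ℝ) * Real.log (Real.sigmoid a * Real.sigmoid b)
    - (1 - (s.toNat : ℝ)) * Real.log (1 - Real.sigmoid a * Real.sigmoid b)

/-- The loss of the parameter `θ = (β, γ)` at one triple: `φ(βᵀX, γᵀX, S)`. -/
def paramLoss {p : ℕ} (θ : Param p) (z : Obs p) : ℝ :=
  loss (θ.1 ⬝ᵥ z.feature) (θ.2 ⬝ᵥ z.feature) z.label

/-- The risk `Q(θ) = E φ(βᵀX, γᵀX, S)` under the law `D` of `(X, Y, S)`. -/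
def risk {p : ℕ} (D : Measure (Obs p)) (θ : Param p) : ℝ := ∫ z, paramLoss θ z ∂D

/-- The empirical risk `Q_n(θ)` of a sample of size `n`. -/
def empRisk {p n : ℕ} (z : Fin n → Obs p) (θ : Param p) : ℝ :=
  (1 / (n : ℝ)) * ∑ i, paramLoss θ (z i)

/-- The excess risk `R(θ) = Q(θ) - Q(θ⋆)`. -/
def excessRisk {p : ℕ} (D : Measure (Obs p)) (θstar θ : Param p) : ℝ :=
  risk D θ - risk D θstar

/-- `θ` is a minimiser of the empirical risk over the `ℓ₁` ball of radius `w` around zero. -/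
def IsBallMinimiser {p n : ℕ} (z : Fin n → Obs p) (w : ℝ) (θ : Param p) : Prop :=
  θ ∈ l1Ball p w ∧ IsMinOn (empRisk z) (l1Ball p w) θ

open Classical in
/-- Keep `(β, γ)` if `|β|₁ > |γ|₁`, otherwise interchange the two components. -/
def reorder {p : ℕ} (θ : Param p) : Param p :=
  if l1 θ.2 < l1 θ.1 then θ else (θ.2, θ.1)

/-- The posterior probability `y(x) = P(Y = 1 | X = x)`. -/
def posterior {p : ℕ} (D : Measure (Obs p)) [IsFiniteMeasure D] (x : Fin p → ℝ) : ℝ :=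
  (condDistrib Obs.trueClass Obs.feature D x).real {true}

/-- The probability of being labelled, `P(S = 1 | X = x, Y = y)`. -/
def labelProb {p : ℕ} (D : Measure (Obs p)) [IsFiniteMeasure D] (x : Fin p → ℝ) (y : Bool) : ℝ :=
  (condDistrib Obs.label (fun z : Obs p => (z.feature, z.trueClass)) D (x, y)).real {true}

/-- The propensity score `e(x) = P(S = 1 | Y = 1, X = x)`. -/
def propensity {p : ℕ} (D : Measure (Obs p)) [IsFiniteMeasure D] (x : Fin p → ℝ) : ℝ :=
  labelProb D x true

/-- The double logistic positive-unlabeled model with ground truth `θ⋆ = (β⋆, γ⋆)`.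
All three conditional probabilities are versions, determined for almost every `x`
(every `{Y = y}` has positive conditional probability given `X = x`, by `posterior_eq`). -/
structure DoubleLogistic {p : ℕ} (D : Measure (Obs p)) [IsFiniteMeasure D]
    (θstar : Param p) : Prop where
  /-- negative instances are never labelled: `P(S = 1 | X = x, Y = 0) = 0` -/
  negative_unlabelled : ∀ᵐ x ∂(D.map Obs.feature), labelProb D x false = 0
  /-- `y(x) = σ(β⋆ᵀ x)` -/
  posterior_eq : ∀ᵐ x ∂(D.map Obs.feature), posterior D x = Real.sigmoid (θstar.1 ⬝ᵥ x)
  /-- `e(x) = σ(γ⋆ᵀ x)` -/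
  propensity_eq : ∀ᵐ x ∂(D.map Obs.feature), propensity D x = Real.sigmoid (θstar.2 ⬝ᵥ x)
  /-- `|β⋆|₁ > |γ⋆|₁` -/
  l1_lt : l1 θstar.2 < l1 θstar.1

/-- The matrix `E X Xᵀ`. -/
def secondMoment {p : ℕ} (D : Measure (Obs p)) : Matrix (Fin p) (Fin p) ℝ :=
  Matrix.of fun j k => ∫ z, z.feature j * z.feature k ∂D

/-- Every predictor is sub-Gaussian: `E exp(t X_j) ≤ exp(μ² t² / 2)` for all real `t`
(the expectation being finite). -/
def SubGaussianFeatures {p : ℕ} (D : Measure (Obs p)) (μ : ℝ≥0) : Prop :=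
  ∀ j, HasSubgaussianMGF (fun z : Obs p => z.feature j) (μ ^ 2) D

/-- The radius `w = C (n / log p)^(1/2 - η)`. -/
def radius (C η : ℝ) (n p : ℕ) : ℝ := C * ((n : ℝ) / Real.log p) ^ (1 / 2 - η)

end PULearning

end

/-! The proof is a basic inequality combined with a Rademacher bound for the empirical process. In
the model P(S = 1 | X) = σ(β⋆ᵀX)σ(γ⋆ᵀX), so R(θ) is an expected Kullback–Leibler divergence between
Bernoulli laws, hence nonnegative (`DoubleLogistic.excessRisk_nonneg`), and only an upper bound is
needed. Since w → ∞ while |θ⋆|₁ stays bounded, θ⋆ eventually lies in the ball. Then Q_n(θ̃) ≤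
Q_n(θ⋆), and R(θ̃) is at most a sum of two deviations of Q_n - Q over the ball
(`mul_excessRisk_le_deviation`).

The expected supremum of a deviation is bounded by symmetrization, then by contraction
(`rademacher_contraction`), which replaces the loss by its two linear scores because it is
1-Lipschitz in each. By ℓ₁–ℓ∞ duality the scores over the ball are at most w times a maximum of 4p
sub-Gaussian sums, of order √(n log p) (`integral_ciSup_deviation_le`). After division by n the
bound has order w√(log p / n) = C(log p / n)^η → 0, and Markov's inequality gives convergence in
probability. Interchanging β and γ changes nothing, because the loss is symmetric in its scores. -/

namespace PULearning

/-! ### Contraction for functions of two scores -/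

section Contraction

/-- The real sign attached to a Boolean: `1` for `true` and `-1` for `false`. -/
def boolSign (e : Bool) : ℝ := if e then 1 else -1

@[simp] lemma boolSign_true : boolSign true = 1 := rfl

@[simp] lemma boolSign_false : boolSign false = -1 := rfl

lemma le_ciSup_of_finite {ι : Type*} [Finite ι] (f : ι → ℝ) (t : ι) : f t ≤ ⨆ t, f t :=
  le_ciSup (Set.finite_range f).bddAbove t

variable {ι : Type*} [Finite ι] [Nonempty ι]

/-- Let t and t' attain the two suprema on the left, and put u = a t - a t', v = b t - b t'.
Evaluating opposite sign pairs at t and t' bounds the right side below by 2(g t + g t') + 2|u + v| +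
2|u - v|. Since |u + v| + |u - v| = 2 max(|u|, |v|) ≥ |u| + |v|, the factor 2 in front of the scores
suffices. -/
lemma contraction_step (g h a b : ι → ℝ)
    (hh : ∀ t t', h t - h t' ≤ |a t - a t'| + |b t - b t'|) :
    2 * ∑ e : Bool, ⨆ t, (g t + boolSign e * h t) ≤
      ∑ e : Bool × Bool, ⨆ t, (g t + 2 * (boolSign e.1 * a t + boolSign e.2 * b t)) := by
  simp only [Fintype.sum_prod_type, Fintype.sum_bool, boolSign_true, boolSign_false]
  obtain ⟨t, ht⟩ := exists_eq_ciSup_of_finite (f := fun t => g t + 1 * h t)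
  obtain ⟨t', ht'⟩ := exists_eq_ciSup_of_finite (f := fun t => g t + -1 * h t)
  rw [← ht, ← ht']
  have key : ∀ x y : ℝ, ∀ s : ι, g s + 2 * (x * a s + y * b s) ≤
      ⨆ t, (g t + 2 * (x * a t + y * b t)) := fun x y s =>
    le_ciSup_of_finite (fun t => g t + 2 * (x * a t + y * b t)) s
  have h1 := key 1 1 t
  have h2 := key 1 1 t'
  have h3 := key (-1) (-1) t
  have h4 := key (-1) (-1) t'
  have h5 := key 1 (-1) t
  have h6 := key 1 (-1) t'
  have h7 := key (-1) 1 t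
  have h8 := key (-1) 1 t'
  have h9 := hh t t'
  rcases abs_cases (a t - a t') with ⟨ha, _⟩ | ⟨ha, _⟩ <;>
    rcases abs_cases (b t - b t') with ⟨hb, _⟩ | ⟨hb, _⟩ <;>
    rw [ha, hb] at h9 <;>
    rcases le_total (|a t - a t'|) (|b t - b t'|) with hc | hc <;>
    rw [ha, hb] at hc <;> linarith

/-- **Contraction principle** for losses depending in a Lipschitz way on two linear scores. -/
theorem rademacher_contraction (n : ℕ) : ∀ (g : ι → ℝ) (h a b : Fin n → ι → ℝ),
    (∀ i t t', h i t - h i t' ≤ |a i t - a i t'| + |b i t - b i t'|) →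
    (2 : ℝ) ^ n * ∑ e : Fin n → Bool, ⨆ t, (g t + ∑ i, boolSign (e i) * h i t) ≤
      ∑ e : Fin n → Bool × Bool,
        ⨆ t, (g t + ∑ i, 2 * (boolSign (e i).1 * a i t + boolSign (e i).2 * b i t)) := by
  induction n with
  | zero => intro g h a b _; simp
  | succ n ih =>
    intro g h a b hh
    have split : ∀ (α : Type) [Fintype α] (F : (Fin (n + 1) → α) → ℝ),
        ∑ e, F e = ∑ x : α, ∑ e : Fin n → α, F (Fin.cons x e) := by
      intro α _ F
      rw [← Fintype.sum_prod_type']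
      exact (Fintype.sum_equiv (Fin.consEquiv fun _ => α) _ _ fun _ => rfl).symm
    rw [split, split]
    simp only [Fin.sum_univ_succ, Fin.cons_zero, Fin.cons_succ]
    -- For a fixed first sign, the term with `h 0` is absorbed into the arbitrary function `g`.
    -- Afterwards the linearised terms join `g`, and `contraction_step` treats the first coordinate.
    have h1 : ∀ x : Bool, (2 : ℝ) ^ n * ∑ e : Fin n → Bool,
        ⨆ t, (g t + (boolSign x * h 0 t + ∑ i, boolSign (e i) * h i.succ t)) ≤
        ∑ e : Fin n → Bool × Bool, ⨆ t, ((g t + boolSign x * h 0 t) +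
          ∑ i, 2 * (boolSign (e i).1 * a i.succ t + boolSign (e i).2 * b i.succ t)) := by
      intro x
      simp only [← add_assoc]
      exact ih _ _ _ _ fun i => hh i.succ
    calc _ = 2 * ∑ x : Bool, (2 : ℝ) ^ n * ∑ e : Fin n → Bool,
        ⨆ t, (g t + (boolSign x * h 0 t + ∑ i, boolSign (e i) * h i.succ t)) := by
          rw [← Finset.mul_sum, pow_succ]; ring
      _ ≤ 2 * ∑ x : Bool, ∑ e : Fin n → Bool × Bool, ⨆ t, ((g t + boolSign x * h 0 t) +
          ∑ i, 2 * (boolSign (e i).1 * a i.succ t + boolSign (e i).2 * b i.succ t)) := by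
          gcongr with x; exact h1 x
      _ = ∑ e : Fin n → Bool × Bool, 2 * ∑ x : Bool, ⨆ t, ((g t +
          ∑ i, 2 * (boolSign (e i).1 * a i.succ t + boolSign (e i).2 * b i.succ t))
            + boolSign x * h 0 t) := by
          rw [Finset.sum_comm, Finset.mul_sum]
          simp only [add_right_comm]
      _ ≤ ∑ e : Fin n → Bool × Bool, ∑ x : Bool × Bool, ⨆ t, ((g t +
          ∑ i, 2 * (boolSign (e i).1 * a i.succ t + boolSign (e i).2 * b i.succ t))
            + 2 * (boolSign x.1 * a 0 t + boolSign x.2 * b 0 t)) := by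
          gcongr with e; exact contraction_step _ _ _ _ (hh 0)
      _ = _ := by
          rw [Finset.sum_comm]
          exact Finset.sum_congr rfl fun x _ => Finset.sum_congr rfl fun e _ =>
            iSup_congr fun t => by ring

end Contraction

/-! ### Expected maximum of finitely many sub-Gaussian variables -/

section Maxima

variable {ι : Type*} [Finite ι] [Nonempty ι] {Ω : Type*} [MeasurableSpace Ω] {P : Measure Ω}

lemma integrable_ciSup_of_finite {f : ι → Ω → ℝ} (hf : ∀ t, Integrable (f t) P) :
    Integrable (fun ω => ⨆ t, f t ω) P := by
  have := Fintype.ofFinite ι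
  refine (integrable_finsetSum Finset.univ fun t _ => (hf t).abs).mono'
    (AEMeasurable.iSup fun t => (hf t).aemeasurable).aestronglyMeasurable (ae_of_all _ fun ω => ?_)
  obtain ⟨t, ht⟩ := exists_eq_ciSup_of_finite (f := fun t => f t ω)
  rw [← ht]
  exact Finset.single_le_sum (f := fun t => |f t ω|) (fun _ _ => abs_nonneg _) (Finset.mem_univ t)

/-- The inequality log x ≤ x - 1 at x = exp(r V_j) / K replaces Jensen's inequality: K bounds the
expectation of ∑ exp(r V_j), so the remainder has nonpositive mean. The parameter r stays free and
is chosen at the end. -/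
lemma integral_ciSup_le_of_hasSubgaussianMGF [IsProbabilityMeasure P] {J : Type*} [Fintype J]
    [Nonempty J] {V : J → Ω → ℝ} {c : ℝ≥0} (hV : ∀ j, HasSubgaussianMGF (V j) c P)
    {r : ℝ} (hr : 0 < r) :
    ∫ ω, ⨆ j, V j ω ∂P ≤ Real.log (Fintype.card J) / r + r * c / 2 := by
  set K : ℝ := Fintype.card J * Real.exp (c * r ^ 2 / 2) with hK
  have hJ : (0 : ℝ) < Fintype.card J := by exact_mod_cast Fintype.card_pos
  have hK0 : 0 < K := by positivity
  have hlog : Real.log K = Real.log (Fintype.card J) + c * r ^ 2 / 2 := by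
    rw [hK, Real.log_mul hJ.ne' (Real.exp_pos _).ne', Real.log_exp]
  have hint : Integrable (fun ω => ∑ j, Real.exp (r * V j ω)) P :=
    integrable_finsetSum _ fun j _ => (hV j).integrable_exp_mul r
  have hpt : ∀ ω, r * ⨆ j, V j ω ≤ Real.log K + (∑ j, Real.exp (r * V j ω)) / K - 1 := by
    intro ω
    obtain ⟨j, hj⟩ := exists_eq_ciSup_of_finite (f := fun j => V j ω)
    rw [← hj]
    have h1 := Real.log_le_sub_one_of_pos (x := Real.exp (r * V j ω) / K) (by positivity)
    rw [Real.log_div (Real.exp_pos _).ne' hK0.ne', Real.log_exp] at h1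
    have h2 : Real.exp (r * V j ω) / K ≤ (∑ j, Real.exp (r * V j ω)) / K := by
      gcongr
      exact Finset.single_le_sum (f := fun j => Real.exp (r * V j ω))
        (fun _ _ => (Real.exp_pos _).le) (Finset.mem_univ j)
    linarith
  have h1 : ∫ ω, r * ⨆ j, V j ω ∂P ≤
      ∫ ω, (Real.log K + (∑ j, Real.exp (r * V j ω)) / K - 1) ∂P :=
    integral_mono ((integrable_ciSup_of_finite fun j => (hV j).integrable).const_mul r)
      (((integrable_const _).add (hint.div_const K)).sub (integrable_const _)) hpt
  have h4 : ∫ ω, (Real.log K + (∑ j, Real.exp (r * V j ω)) / K - 1) ∂P =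
      ∫ _, Real.log K ∂P + ∫ ω, (∑ j, Real.exp (r * V j ω)) / K ∂P - ∫ _, (1 : ℝ) ∂P := by
    rw [← integral_add (integrable_const _) (hint.div_const K)]
    exact integral_sub ((integrable_const _).add (hint.div_const K)) (integrable_const _)
  rw [integral_const_mul, h4, integral_div,
    integral_finsetSum _ fun j _ => (hV j).integrable_exp_mul r] at h1
  have h2 : ∑ j, ∫ ω, Real.exp (r * V j ω) ∂P ≤ K := by
    calc _ ≤ ∑ _j : J, Real.exp (c * r ^ 2 / 2) := Finset.sum_le_sum fun j _ => (hV j).mgf_le r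
      _ = K := by simp [hK]
  have h3 : (∑ j, ∫ ω, Real.exp (r * V j ω) ∂P) / K ≤ 1 := (div_le_one hK0).2 h2
  simp only [integral_const, probReal_univ, one_smul] at h1
  rw [show Real.log (Fintype.card J) / r + r * c / 2
    = (Real.log (Fintype.card J) + c * r ^ 2 / 2) / r by field_simp, le_div_iff₀ hr]
  linarith

end Maxima

/-! ### Symmetrization by a ghost sample -/

section Symmetrization

variable {ι : Type*} [Finite ι] [Nonempty ι] {E : Type*} [MeasurableSpace E] {D : Measure E}
  [IsProbabilityMeasure D] {n : ℕ}

lemma integrable_sum_pi {f : E → ℝ} (c : Fin n → ℝ) (hf : Integrable f D) :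
    Integrable (fun z : Fin n → E => ∑ i, c i * f (z i)) (Measure.pi fun _ => D) :=
  integrable_finsetSum _ fun i _ =>
    ((measurePreserving_eval (fun _ : Fin n => D) i).integrable_comp_of_integrable hf).const_mul _

/-- **Symmetrization**, with a fixed choice of signs. -/
theorem integral_ciSup_sub_le_signed {f : ι → E → ℝ} (hf : ∀ t, Integrable (f t) D)
    (e : Fin n → Bool) :
    ∫ z : Fin n → E, ⨆ t, ∑ i, (f t (z i) - ∫ x, f t x ∂D) ∂(Measure.pi fun _ => D) ≤
      ∫ z : Fin n → E, ⨆ t, ∑ i, boolSign (e i) * f t (z i) ∂(Measure.pi fun _ => D) +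
      ∫ z : Fin n → E, ⨆ t, ∑ i, boolSign (!e i) * f t (z i) ∂(Measure.pi fun _ => D) := by
  set M : Measure (Fin n → E) := Measure.pi fun _ => D
  have hI : ∀ (c : Fin n → ℝ) t, Integrable (fun z : Fin n → E => ∑ i, c i * f t (z i)) M :=
    fun c t => integrable_sum_pi c (hf t)
  have hI1 : ∀ t, Integrable (fun z : Fin n → E => ∑ i, f t (z i)) M := fun t => by
    simpa using hI (fun _ => 1) t
  have hIs : ∀ e : Fin n → Bool,
      Integrable (fun z : Fin n → E => ⨆ t, ∑ i, boolSign (e i) * f t (z i)) M :=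
    fun e => integrable_ciSup_of_finite fun t => hI _ t
  have hmean : ∀ t, ∫ z, ∑ i, f t (z i) ∂M = ∑ _i : Fin n, ∫ x, f t x ∂D := by
    intro t
    have hti : ∀ i, Integrable (fun z : Fin n → E => f t (z i)) M := fun i =>
      (measurePreserving_eval (fun _ : Fin n => D) i).integrable_comp_of_integrable (hf t)
    rw [integral_finsetSum _ fun i _ => hti i]
    refine Finset.sum_congr rfl fun i _ => ?_
    have := (measurePreserving_eval (fun _ : Fin n => D) i)
    rw [← this.map_eq, integral_map this.measurable.aemeasurable]
    rw [this.map_eq]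
    exact (hf t).aestronglyMeasurable
  set G : (Fin n → E) × (Fin n → E) → ℝ :=
    fun w => ⨆ t, (∑ i, f t (w.1 i) - ∑ i, f t (w.2 i))
  have hGi : Integrable G (M.prod M) := integrable_ciSup_of_finite fun t =>
    ((hI1 t).comp_fst M).sub ((hI1 t).comp_snd M)
  -- The mean is an integral over an independent ghost sample, and a supremum of integrals is at
  -- most the integral of the supremum.
  have step1 : ∫ z, ⨆ t, ∑ i, (f t (z i) - ∫ x, f t x ∂D) ∂M ≤ ∫ w, G w ∂(M.prod M) := by
    rw [integral_prod _ hGi]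
    refine integral_mono_ae (integrable_ciSup_of_finite fun t => ?_) hGi.integral_prod_left ?_
    · simp only [Finset.sum_sub_distrib]
      exact (hI1 t).sub (integrable_const _)
    filter_upwards [hGi.prod_right_ae] with z hz
    refine ciSup_le fun t => ?_
    rw [Finset.sum_sub_distrib, ← hmean]
    calc _ = ∫ z', (∑ i, f t (z i) - ∑ i, f t (z' i)) ∂M := by
          rw [integral_sub (integrable_const _) (hI1 t)]; simp
      _ ≤ _ := integral_mono ((integrable_const _).sub (hI1 t)) hz fun z' =>
          le_ciSup_of_finite (fun t => ∑ i, f t (z i) - ∑ i, f t (z' i)) t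
  have hA := measurePreserving_arrowProdEquivProdArrow E E (Fin n) (fun _ => D) (fun _ => D)
  set W : Measure (Fin n → E × E) := Measure.pi fun _ => D.prod D
  have step2 : ∫ w, G w ∂(M.prod M) =
      ∫ w, ⨆ t, (∑ i, f t (w i).1 - ∑ i, f t (w i).2) ∂W := by
    rw [← hA.integral_comp']; rfl
  -- Exchanging z_i with its ghost copy wherever `e i` is false preserves the law and flips the sign
  -- of that difference.
  have hS : MeasurePreserving (fun (w : Fin n → E × E) i => if e i then w i else (w i).swap) W W := by
    refine measurePreserving_pi (fun _ : Fin n => D.prod D) (fun _ : Fin n => D.prod D)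
      (f := fun i w => if e i then w else w.swap) fun i => ?_
    cases e i
    · exact Measure.measurePreserving_swap
    · exact MeasurePreserving.id _
  have hGW : AEStronglyMeasurable
      (fun w : Fin n → E × E => ⨆ t, (∑ i, f t (w i).1 - ∑ i, f t (w i).2)) W :=
    (hA.integrable_comp_of_integrable hGi).aestronglyMeasurable
  have step3 : ∫ w, ⨆ t, (∑ i, f t (w i).1 - ∑ i, f t (w i).2) ∂W =
      ∫ w, ⨆ t, (∑ i, boolSign (e i) * f t (w i).1 + ∑ i, boolSign (!e i) * f t (w i).2) ∂W := by
    conv_lhs => rw [← hS.map_eq]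
    rw [integral_map hS.measurable.aemeasurable (by rwa [hS.map_eq])]
    refine integral_congr_ae (ae_of_all _ fun w => ?_)
    refine iSup_congr fun t => ?_
    rw [← Finset.sum_sub_distrib, ← Finset.sum_add_distrib]
    refine Finset.sum_congr rfl fun i _ => ?_
    cases hei : e i
    · simp [hei, sub_eq_neg_add]
    · simp [hei, sub_eq_add_neg]
  have hGi' : Integrable (fun w : (Fin n → E) × (Fin n → E) => ⨆ t, (∑ i, boolSign (e i) * f t (w.1 i)
      + ∑ i, boolSign (!e i) * f t (w.2 i))) (M.prod M) := integrable_ciSup_of_finite fun t =>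
    ((hI _ t).comp_fst M).add ((hI _ t).comp_snd M)
  have step4 :
      ∫ w, ⨆ t, (∑ i, boolSign (e i) * f t (w i).1 + ∑ i, boolSign (!e i) * f t (w i).2) ∂W
      = ∫ w, ⨆ t, (∑ i, boolSign (e i) * f t (w.1 i)
        + ∑ i, boolSign (!e i) * f t (w.2 i)) ∂(M.prod M) := by
    rw [← hA.integral_comp']; rfl
  have step5 : ∫ w, ⨆ t, (∑ i, boolSign (e i) * f t (w.1 i)
        + ∑ i, boolSign (!e i) * f t (w.2 i)) ∂(M.prod M) ≤
      ∫ w, ((⨆ t, ∑ i, boolSign (e i) * f t (w.1 i))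
        + ⨆ t, ∑ i, boolSign (!e i) * f t (w.2 i)) ∂(M.prod M) :=
    integral_mono hGi' (((hIs e).comp_fst M).add ((hIs fun i => !e i).comp_snd M)) fun w =>
      ciSup_le fun t => add_le_add
        (le_ciSup_of_finite (fun t => ∑ i, boolSign (e i) * f t (w.1 i)) t)
        (le_ciSup_of_finite (fun t => ∑ i, boolSign (!e i) * f t (w.2 i)) t)
  rw [integral_add ((hIs e).comp_fst M) ((hIs fun i => !e i).comp_snd M)] at step5
  have h6 := integral_fun_fst (μ := M) (ν := M)
    (fun z : Fin n → E => ⨆ t, ∑ i, boolSign (e i) * f t (z i))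
  have h7 := integral_fun_snd (μ := M) (ν := M)
    (fun z : Fin n → E => ⨆ t, ∑ i, boolSign (!e i) * f t (z i))
  simp only [probReal_univ, one_smul] at h6 h7
  rw [h6, h7] at step5
  linarith

/-- **Symmetrization**, averaged over all signs. -/
theorem integral_ciSup_sub_le_rademacher {f : ι → E → ℝ} (hf : ∀ t, Integrable (f t) D) :
    2 ^ n * ∫ z : Fin n → E, ⨆ t, ∑ i, (f t (z i) - ∫ x, f t x ∂D) ∂(Measure.pi fun _ => D) ≤
      2 * ∫ z : Fin n → E, ∑ e : Fin n → Bool, ⨆ t, ∑ i, boolSign (e i) * f t (z i)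
        ∂(Measure.pi fun _ => D) := by
  have hsum := Finset.sum_le_sum fun (e : Fin n → Bool) (_ : e ∈ Finset.univ) =>
    integral_ciSup_sub_le_signed hf e
  rw [Finset.sum_add_distrib] at hsum
  have hneg := Fintype.sum_equiv (Equiv.piCongrRight fun _ : Fin n => Equiv.boolNot)
    (fun e => ∫ z : Fin n → E, ⨆ t, ∑ i, boolSign (!e i) * f t (z i) ∂(Measure.pi fun _ => D))
    (fun e => ∫ z : Fin n → E, ⨆ t, ∑ i, boolSign (e i) * f t (z i) ∂(Measure.pi fun _ => D))
    (fun e => rfl)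
  rw [hneg, ← two_mul] at hsum
  rw [integral_finsetSum _ fun e _ => integrable_ciSup_of_finite fun t => integrable_sum_pi _ (hf t)]
  simpa using hsum

end Symmetrization

/-! ### Lipschitz continuity of the loss -/

section Loss

lemma sigmoid_mul_sigmoid_pos (a b : ℝ) : 0 < Real.sigmoid a * Real.sigmoid b :=
  mul_pos (Real.sigmoid_pos a) (Real.sigmoid_pos b)

lemma sigmoid_mul_sigmoid_lt (a b : ℝ) : Real.sigmoid a * Real.sigmoid b < Real.sigmoid a :=
  mul_lt_of_lt_one_right (Real.sigmoid_pos a) (Real.sigmoid_lt_one b)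

lemma sigmoid_mul_sigmoid_lt_one (a b : ℝ) : Real.sigmoid a * Real.sigmoid b < 1 :=
  (sigmoid_mul_sigmoid_lt a b).trans (Real.sigmoid_lt_one a)

lemma loss_true (a b : ℝ) : loss a b true = -Real.log (Real.sigmoid a * Real.sigmoid b) := by
  simp [loss]

lemma loss_false (a b : ℝ) :
    loss a b false = -Real.log (1 - Real.sigmoid a * Real.sigmoid b) := by
  simp [loss]

lemma loss_comm (a b : ℝ) (s : Bool) : loss a b s = loss b a s := by
  simp only [loss, mul_comm (Real.sigmoid a)]

/-- The derivative in a is -(1 - σ(a)) for s = 1 and σ(a)(1 - σ(a))σ(b) / (1 - σ(a)σ(b)) for s = 0.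
The latter is at most 1 because 1 - σ(a) ≤ 1 - σ(a)σ(b). -/
lemma loss_left_lipschitz (a a' b : ℝ) (s : Bool) : |loss a b s - loss a' b s| ≤ |a - a'| := by
  obtain ⟨f', hf', hb⟩ : ∃ f' : ℝ → ℝ,
      (∀ x, HasDerivAt (fun x => loss x b s) (f' x) x) ∧ ∀ x, |f' x| ≤ 1 := by
    have hσ : ∀ x, HasDerivAt (fun x => Real.sigmoid x * Real.sigmoid b)
        (Real.sigmoid x * (1 - Real.sigmoid x) * Real.sigmoid b) x := fun x =>
      (Real.hasDerivAt_sigmoid x).mul_const _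
    cases s
    · simp only [loss_false]
      refine ⟨_, fun x => (((hσ x).const_sub 1).log
        (sub_pos.2 (sigmoid_mul_sigmoid_lt_one x b)).ne').neg, fun x => ?_⟩
      have h0 := Real.sigmoid_pos x
      have h1 := Real.sigmoid_lt_one x
      have h2 := Real.sigmoid_pos b
      have h3 := Real.sigmoid_lt_one b
      have h4 := sub_pos.2 (sigmoid_mul_sigmoid_lt_one x b)
      rw [neg_div, neg_neg, abs_div, abs_of_pos h4, div_le_one h4,
        abs_of_nonneg (by have := sub_pos.2 h1; positivity)]
      nlinarith [mul_pos h0 h2, mul_pos (mul_pos h0 h2) h0, sigmoid_mul_sigmoid_lt x b,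
        mul_pos (sub_pos.2 h1) (sub_pos.2 (sigmoid_mul_sigmoid_lt_one x b)),
        mul_pos (mul_pos h0 h2) (sub_pos.2 h1), mul_pos (mul_pos h0 (sub_pos.2 h3)) (sub_pos.2 h1),
        mul_pos (mul_pos h0 (sub_pos.2 h3)) h0]
    · simp only [loss_true]
      refine ⟨_, fun x => ((hσ x).log (sigmoid_mul_sigmoid_pos x b).ne').neg, fun x => ?_⟩
      have h0 := Real.sigmoid_pos x
      have h1 := Real.sigmoid_lt_one x
      have h2 := Real.sigmoid_pos b
      have : Real.sigmoid x * (1 - Real.sigmoid x) * Real.sigmoid b /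
        (Real.sigmoid x * Real.sigmoid b) = 1 - Real.sigmoid x := by field_simp
      rw [abs_neg, this, abs_le]
      constructor <;> linarith
  have := Convex.norm_image_sub_le_of_norm_hasDerivWithin_le (𝕜 := ℝ) (s := Set.univ)
    (f := fun x => loss x b s) (f' := f') (C := 1) (x := a') (y := a)
    (fun x _ => (hf' x).hasDerivWithinAt) (fun x _ => hb x) convex_univ trivial trivial
  simpa using this

lemma loss_lipschitz (a b a' b' : ℝ) (s : Bool) :
    |loss a b s - loss a' b' s| ≤ |a - a'| + |b - b'| := by
  have h1 := loss_left_lipschitz a a' b s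
  have h2 := loss_left_lipschitz b b' a' s
  rw [loss_comm b, loss_comm b'] at h2
  calc _ = |(loss a b s - loss a' b s) + (loss a' b s - loss a' b' s)| := by ring_nf
    _ ≤ _ := (abs_add_le _ _).trans (add_le_add h1 h2)

end Loss

/-! ### The centred loss as a function of the parameter -/

variable {p : ℕ}

lemma l1_nonneg (a : Fin p → ℝ) : 0 ≤ l1 a := Finset.sum_nonneg fun _ _ => abs_nonneg _

lemma abs_dotProduct_le (a x : Fin p → ℝ) {m : ℝ} (hx : ∀ j, |x j| ≤ m) :
    |a ⬝ᵥ x| ≤ l1 a * m := by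
  rw [l1, Finset.sum_mul]
  refine (Finset.abs_sum_le_sum_abs _ _).trans (Finset.sum_le_sum fun j _ => ?_)
  rw [abs_mul]
  exact mul_le_mul_of_nonneg_left (hx j) (abs_nonneg _)

/-- The loss of `θ` at a triple, relative to the loss of the zero parameter. -/
noncomputable def centredLoss (θ : Param p) (z : Obs p) : ℝ := paramLoss θ z - paramLoss 0 z

@[simp] lemma centredLoss_zero (z : Obs p) : centredLoss 0 z = 0 := sub_self _

lemma abs_centredLoss_sub_le (θ θ' : Param p) (z : Obs p) :
    |centredLoss θ z - centredLoss θ' z| ≤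
      |θ.1 ⬝ᵥ z.feature - θ'.1 ⬝ᵥ z.feature| + |θ.2 ⬝ᵥ z.feature - θ'.2 ⬝ᵥ z.feature| := by
  rw [centredLoss, centredLoss, sub_sub_sub_cancel_right]
  exact loss_lipschitz _ _ _ _ _

/-- The `ℓ₁` norm of the feature vector of a triple. -/
noncomputable def featureL1 (z : Obs p) : ℝ := ∑ j, |z.feature j|

lemma abs_feature_le (z : Obs p) (j : Fin p) : |z.feature j| ≤ featureL1 z :=
  Finset.single_le_sum (f := fun j => |z.feature j|) (fun _ _ => abs_nonneg _) (Finset.mem_univ j)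

lemma abs_centredLoss_sub_le_l1 (θ θ' : Param p) (z : Obs p) :
    |centredLoss θ z - centredLoss θ' z| ≤ Param.l1 (θ - θ') * featureL1 z := by
  refine (abs_centredLoss_sub_le θ θ' z).trans ?_
  rw [← sub_dotProduct, ← sub_dotProduct, Param.l1, add_mul]
  exact add_le_add (abs_dotProduct_le _ _ (abs_feature_le z))
    (abs_dotProduct_le _ _ (abs_feature_le z))

lemma measurable_feature : Measurable (Obs.feature : Obs p → Fin p → ℝ) := measurable_fst

lemma measurable_label : Measurable (Obs.label : Obs p → Bool) := measurable_snd.snd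

lemma measurable_trueClass : Measurable (Obs.trueClass : Obs p → Bool) := measurable_snd.fst

lemma measurable_dotProduct_right (a : Fin p → ℝ) : Measurable fun x : Fin p → ℝ => a ⬝ᵥ x :=
  Finset.measurable_sum _ fun j _ => (measurable_pi_apply j).const_mul _

lemma measurable_paramLoss (θ : Param p) : Measurable (paramLoss θ) := by
  have hσ : ∀ a : Fin p → ℝ, Measurable fun z : Obs p => Real.sigmoid (a ⬝ᵥ z.feature) := fun a =>
    continuous_sigmoid.measurable.comp ((measurable_dotProduct_right a).comp measurable_feature)
  have hs : Measurable fun z : Obs p => (z.label.toNat : ℝ) :=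
    (Measurable.of_discrete (f := fun s : Bool => (s.toNat : ℝ))).comp measurable_label
  exact (hs.neg.mul (Real.measurable_log.comp ((hσ _).mul (hσ _)))).sub
    ((hs.const_sub 1).mul (Real.measurable_log.comp (((hσ _).mul (hσ _)).const_sub 1)))

lemma measurable_centredLoss (θ : Param p) : Measurable (centredLoss θ) :=
  (measurable_paramLoss θ).sub (measurable_paramLoss 0)

/-! ### Integrability and continuity of the risk -/

section Risk

variable {D : Measure (Obs p)} (hX : ∀ j, Integrable (fun z : Obs p => z.feature j) D)
include hX

lemma integrable_featureL1 : Integrable (featureL1 : Obs p → ℝ) D :=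
  integrable_finsetSum _ fun j _ => (hX j).abs

lemma integrable_centredLoss (θ : Param p) : Integrable (centredLoss θ) D := by
  refine ((integrable_featureL1 hX).const_mul (Param.l1 θ)).mono'
    (measurable_centredLoss θ).aestronglyMeasurable (ae_of_all _ fun z => ?_)
  simpa using abs_centredLoss_sub_le_l1 θ 0 z

lemma integrable_paramLoss [IsFiniteMeasure D] (θ : Param p) : Integrable (paramLoss θ) D := by
  have h0 : Integrable (paramLoss (0 : Param p)) D := by
    refine (integrable_const (|loss 0 0 true| + |loss 0 0 false|)).mono'
      (measurable_paramLoss 0).aestronglyMeasurable (ae_of_all _ fun z => ?_)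
    rw [paramLoss, Prod.fst_zero, Prod.snd_zero, zero_dotProduct, Real.norm_eq_abs]
    cases z.label
    · exact le_add_of_nonneg_left (abs_nonneg _)
    · exact le_add_of_nonneg_right (abs_nonneg _)
  have := (integrable_centredLoss hX θ).add h0
  exact this.congr (ae_of_all _ fun z => sub_add_cancel _ _)

lemma integral_centredLoss [IsFiniteMeasure D] (θ : Param p) :
    ∫ z, centredLoss θ z ∂D = risk D θ - risk D 0 :=
  integral_sub (integrable_paramLoss hX θ) (integrable_paramLoss hX 0)

lemma continuous_integral_centredLoss : Continuous fun θ : Param p => ∫ z, centredLoss θ z ∂D := by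
  rw [continuous_iff_continuousAt]
  intro θ
  rw [ContinuousAt, tendsto_iff_norm_sub_tendsto_zero]
  have hl : Tendsto (fun θ' : Param p => Param.l1 (θ' - θ) * ∫ z, featureL1 z ∂D) (𝓝 θ) (𝓝 0) := by
    have : Continuous fun θ' : Param p => Param.l1 (θ' - θ) * ∫ z, featureL1 z ∂D := by
      unfold Param.l1 l1
      fun_prop
    simpa [Param.l1, l1] using this.tendsto θ
  refine squeeze_zero (fun _ => norm_nonneg _) (fun θ' => ?_) hl
  rw [← integral_sub (integrable_centredLoss hX θ') (integrable_centredLoss hX θ),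
    ← integral_const_mul]
  exact norm_integral_le_of_norm_le ((integrable_featureL1 hX).const_mul _)
    (ae_of_all _ fun z => abs_centredLoss_sub_le_l1 θ' θ z)

end Risk

lemma continuous_centredLoss (z : Obs p) : Continuous fun θ : Param p => centredLoss θ z := by
  rw [continuous_iff_continuousAt]
  intro θ
  rw [ContinuousAt, tendsto_iff_norm_sub_tendsto_zero]
  have hl : Tendsto (fun θ' : Param p => Param.l1 (θ' - θ) * featureL1 z) (𝓝 θ) (𝓝 0) := by
    have : Continuous fun θ' : Param p => Param.l1 (θ' - θ) * featureL1 z := by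
      unfold Param.l1 l1
      fun_prop
    simpa [Param.l1, l1] using this.tendsto θ
  exact squeeze_zero (fun _ => norm_nonneg _) (fun θ' => abs_centredLoss_sub_le_l1 θ' θ z) hl

/-! ### Expected supremum of the empirical process -/

section EmpiricalProcess

variable {D : Measure (Obs p)} {n : ℕ} {μ : ℝ≥0}

lemma SubGaussianFeatures.integrable (hD : SubGaussianFeatures D μ) (j : Fin p) :
    Integrable (fun z : Obs p => z.feature j) D := (hD j).integrable

lemma hasSubgaussianMGF_boolSign_mul {Ω : Type*} [MeasurableSpace Ω] {P : Measure Ω} {X : Ω → ℝ}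
    {c : ℝ≥0} (hX : HasSubgaussianMGF X c P) (e : Bool) :
    HasSubgaussianMGF (fun ω => boolSign e * X ω) c P := by
  cases e
  · simpa [Pi.neg_def] using hX.neg
  · simpa using hX

variable [IsProbabilityMeasure D]

/-- The `j`-th coordinate of the signed feature sum. -/
noncomputable def signedFeatureSum (c : Fin n → Bool) (z : Fin n → Obs p) (j : Fin p) : ℝ :=
  ∑ i, boolSign (c i) * (z i).feature j

lemma sum_boolSign_mul_dotProduct (c : Fin n → Bool) (z : Fin n → Obs p) (a : Fin p → ℝ) :
    ∑ i, boolSign (c i) * (a ⬝ᵥ (z i).feature) = a ⬝ᵥ signedFeatureSum c z := by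
  simp only [dotProduct, signedFeatureSum, Finset.mul_sum]
  rw [Finset.sum_comm]
  exact Finset.sum_congr rfl fun _ _ => Finset.sum_congr rfl fun _ _ => by ring

lemma hasSubgaussianMGF_signedFeatureSum (hD : SubGaussianFeatures D μ) (c : Fin n → Bool)
    (j : Fin p) :
    HasSubgaussianMGF (fun z : Fin n → Obs p => signedFeatureSum c z j) (n * μ ^ 2)
      (Measure.pi fun _ => D) := by
  have hsub : ∀ i, HasSubgaussianMGF (fun x : Obs p => boolSign (c i) * x.feature j) (μ ^ 2) D :=
    fun i => hasSubgaussianMGF_boolSign_mul (hD j) (c i)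
  have hind := iIndepFun_pi (μ := fun _ : Fin n => D)
    (X := fun i x => boolSign (c i) * x.feature j) fun i => (hsub i).aemeasurable
  have hi : ∀ i ∈ Finset.univ, HasSubgaussianMGF
      (fun z : Fin n → Obs p => boolSign (c i) * (z i).feature j) (μ ^ 2)
      (Measure.pi fun _ => D) := by
    intro i _
    have he := measurePreserving_eval (fun _ : Fin n => D) i
    refine HasSubgaussianMGF.of_map (Y := fun z : Fin n → Obs p => z i)
      (X := fun x : Obs p => boolSign (c i) * x.feature j) he.measurable.aemeasurable ?_
    rw [show (fun z : Fin n → Obs p => z i) = Function.eval i from rfl, he.map_eq]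
    exact hsub i
  have := HasSubgaussianMGF.sum_of_iIndepFun hind hi
  simpa [signedFeatureSum] using this

variable {ι : Type*} [Finite ι] [Nonempty ι]

/-- By ℓ₁–ℓ∞ duality the supremum is at most 2w times a maximum of 4p variables, indexed by a
coordinate, the choice between the β and γ signs, and a sign that produces the absolute value. The
signs `e` are fixed: sub-Gaussianity is insensitive to them. -/
lemma integral_ciSup_linear_le [NeZero p] (hD : SubGaussianFeatures D μ) {w : ℝ}
    {θ : ι → Param p} (hθ : ∀ t, θ t ∈ l1Ball p w) (e : Fin n → Bool × Bool) {r : ℝ} (hr : 0 < r) :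
    ∫ z : Fin n → Obs p, ⨆ t, (∑ i, 2 * (boolSign (e i).1 * ((θ t).1 ⬝ᵥ (z i).feature) +
        boolSign (e i).2 * ((θ t).2 ⬝ᵥ (z i).feature))) ∂(Measure.pi fun _ => D) ≤
      2 * w * (Real.log (4 * p) / r + r * (n * μ ^ 2) / 2) := by
  set V : Fin p × Bool × Bool → (Fin n → Obs p) → ℝ := fun k z =>
    boolSign k.2.2 * signedFeatureSum (fun i => if k.2.1 then (e i).1 else (e i).2) z k.1 with hV
  have hVs : ∀ k, HasSubgaussianMGF (V k) (n * μ ^ 2) (Measure.pi fun _ => D) := fun k =>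
    hasSubgaussianMGF_boolSign_mul (hasSubgaussianMGF_signedFeatureSum hD _ _) _
  have hmax := integral_ciSup_le_of_hasSubgaussianMGF hVs hr
  have hcard : ((Fintype.card (Fin p × Bool × Bool) : ℕ) : ℝ) = 4 * p := by
    simp; ring
  rw [hcard] at hmax
  push_cast at hmax
  have hw : 0 ≤ w := by
    obtain ⟨t⟩ := ‹Nonempty ι›
    exact (add_nonneg (l1_nonneg _) (l1_nonneg _)).trans (hθ t)
  have hX := hD.integrable
  have hint1 : ∀ (a : Fin p → ℝ) (i : Fin n), Integrable
      (fun z : Fin n → Obs p => a ⬝ᵥ (z i).feature) (Measure.pi fun _ => D) := fun a i =>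
    (measurePreserving_eval (fun _ : Fin n => D) i).integrable_comp_of_integrable
      (g := fun x : Obs p => a ⬝ᵥ x.feature)
      (integrable_finsetSum _ fun j _ => (hX j).const_mul (a j))
  refine (integral_mono (integrable_ciSup_of_finite fun t => integrable_finsetSum _ fun i _ =>
    (((hint1 _ i).const_mul _).add ((hint1 _ i).const_mul _)).const_mul 2)
    ((integrable_ciSup_of_finite fun k => (hVs k).integrable).const_mul (2 * w))
    fun z => ciSup_le fun t => ?_).trans ?_
  · have hle : ∀ k, V k z ≤ ⨆ k, V k z := le_ciSup_of_finite fun k => V k z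
    set m := ⨆ k, V k z
    have h1 : ∀ j, |signedFeatureSum (fun i => (e i).1) z j| ≤ m := fun j =>
      abs_le'.2 ⟨by simpa [hV] using hle (j, true, true), by simpa [hV] using hle (j, true, false)⟩
    have h2 : ∀ j, |signedFeatureSum (fun i => (e i).2) z j| ≤ m := fun j =>
      abs_le'.2 ⟨by simpa [hV] using hle (j, false, true), by simpa [hV] using hle (j, false, false)⟩
    have hm : 0 ≤ m := (abs_nonneg _).trans (h1 0)
    simp only [Pi.add_apply]
    rw [← Finset.mul_sum, Finset.sum_add_distrib, sum_boolSign_mul_dotProduct,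
      sum_boolSign_mul_dotProduct, mul_assoc]
    refine mul_le_mul_of_nonneg_left ?_ zero_le_two
    calc _ ≤ l1 (θ t).1 * m + l1 (θ t).2 * m := add_le_add
          ((le_abs_self _).trans (abs_dotProduct_le _ _ h1))
          ((le_abs_self _).trans (abs_dotProduct_le _ _ h2))
      _ = Param.l1 (θ t) * m := by rw [Param.l1, add_mul]
      _ ≤ w * m := mul_le_mul_of_nonneg_right (hθ t) hm
  · rw [integral_const_mul]
    exact mul_le_mul_of_nonneg_left hmax (by positivity)

/-- Bound on the expected one-sided maximal deviation of the signed loss over finitely many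
parameters in an `ℓ₁` ball. -/
theorem integral_ciSup_deviation_le [NeZero p] (hD : SubGaussianFeatures D μ) {w : ℝ}
    {θ : ι → Param p} (hθ : ∀ t, θ t ∈ l1Ball p w) (s : Bool) {r : ℝ} (hr : 0 < r) :
    ∫ z : Fin n → Obs p, ⨆ t, ∑ i, (boolSign s * centredLoss (θ t) (z i) -
        ∫ x, boolSign s * centredLoss (θ t) x ∂D) ∂(Measure.pi fun _ => D) ≤
      4 * w * (Real.log (4 * p) / r + r * (n * μ ^ 2) / 2) := by
  set K := Real.log (4 * p) / r + r * (n * μ ^ 2) / 2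
  have hX := hD.integrable
  have hf : ∀ t, Integrable (fun x => boolSign s * centredLoss (θ t) x) D := fun t =>
    (integrable_centredLoss hX _).const_mul _
  have hint1 : ∀ (a : Fin p → ℝ) (i : Fin n), Integrable
      (fun z : Fin n → Obs p => a ⬝ᵥ (z i).feature) (Measure.pi fun _ => D) := fun a i =>
    (measurePreserving_eval (fun _ : Fin n => D) i).integrable_comp_of_integrable
      (g := fun x : Obs p => a ⬝ᵥ x.feature)
      (integrable_finsetSum _ fun j _ => (hX j).const_mul (a j))
  have hI : ∀ e : Fin n → Bool × Bool, Integrable (fun z : Fin n → Obs p =>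
      ⨆ t, (∑ i, 2 * (boolSign (e i).1 * ((θ t).1 ⬝ᵥ (z i).feature) +
        boolSign (e i).2 * ((θ t).2 ⬝ᵥ (z i).feature)))) (Measure.pi fun _ => D) := fun e =>
    integrable_ciSup_of_finite fun t => integrable_finsetSum _ fun i _ =>
      (((hint1 _ i).const_mul _).add ((hint1 _ i).const_mul _)).const_mul 2
  have hsym := integral_ciSup_sub_le_rademacher (n := n) hf
  have hcon : ∫ z : Fin n → Obs p, 2 ^ n * ∑ e : Fin n → Bool, ⨆ t, ∑ i, boolSign (e i) *
        (boolSign s * centredLoss (θ t) (z i)) ∂(Measure.pi fun _ => D) ≤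
      ∫ z : Fin n → Obs p, ∑ e : Fin n → Bool × Bool,
        ⨆ t, (∑ i, 2 * (boolSign (e i).1 * ((θ t).1 ⬝ᵥ (z i).feature) +
        boolSign (e i).2 * ((θ t).2 ⬝ᵥ (z i).feature))) ∂(Measure.pi fun _ => D) := by
    refine integral_mono ((integrable_finsetSum _ fun e _ => integrable_ciSup_of_finite fun t =>
      integrable_sum_pi _ (hf t)).const_mul _) (integrable_finsetSum _ fun e _ => hI e) fun z => ?_
    have := rademacher_contraction n (fun _ : ι => (0 : ℝ))
      (fun i t => boolSign s * centredLoss (θ t) (z i)) (fun i t => (θ t).1 ⬝ᵥ (z i).feature)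
      (fun i t => (θ t).2 ⬝ᵥ (z i).feature) fun i t t' => by
        have h1 := abs_le.1 (abs_centredLoss_sub_le (θ t) (θ t') (z i))
        cases s <;> simp only [boolSign_true, boolSign_false] <;> linarith [h1.1, h1.2]
    simpa only [zero_add] using this
  rw [integral_const_mul, integral_finsetSum _ fun e _ => hI e] at hcon
  have hlin := Finset.sum_le_sum fun (e : Fin n → Bool × Bool) (_ : e ∈ Finset.univ) =>
    integral_ciSup_linear_le hD hθ e hr
  simp only [Finset.sum_const, Finset.card_univ, nsmul_eq_mul] at hlin
  -- The 4^n sign patterns cancel against one factor 2^n from contraction and one from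
  -- symmetrization. The remaining 2 of symmetrization turns 2w into 4w.
  have hcard : ((Fintype.card (Fin n → Bool × Bool) : ℕ) : ℝ) = 2 ^ n * 2 ^ n := by
    simp [← mul_pow]; norm_num
  rw [hcard] at hlin
  have h2 : (0 : ℝ) < 2 ^ n := by positivity
  have h3 := le_of_mul_le_mul_left ((hcon.trans hlin).trans_eq (mul_assoc _ _ _)) h2
  refine le_of_mul_le_mul_left (hsym.trans ?_) h2
  calc _ ≤ 2 * (2 ^ n * (2 * w * K)) := mul_le_mul_of_nonneg_left h3 zero_le_two
    _ = _ := by ring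

end EmpiricalProcess

/-! ### Nonnegativity and symmetry of the excess risk -/

section ExcessRisk

/-- If `q(X)` is the conditional probability of `{B = 1}` given `X`, then `E[B h(X)] = E[q(X) h(X)]`. -/
lemma integral_bool_mul_eq {Ω E : Type*} [MeasurableSpace Ω] [MeasurableSpace E] {D : Measure Ω}
    [IsFiniteMeasure D] {X : Ω → E} {B : Ω → Bool} (hX : Measurable X) (hB : Measurable B)
    {q h : E → ℝ} (hq : ∀ᵐ ω ∂D, (condDistrib B X D (X ω)).real {true} = q (X ω))
    (hh : Measurable h) (hi : Integrable (fun ω => h (X ω)) D) :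
    ∫ ω, ((B ω).toNat : ℝ) * h (X ω) ∂D = ∫ ω, q (X ω) * h (X ω) ∂D := by
  have hind : (fun ω => ((B ω).toNat : ℝ)) = (B ⁻¹' {true}).indicator fun _ => (1 : ℝ) := by
    funext ω
    cases hω : B ω <;> simp [Set.indicator, hω]
  have hBm : Measurable fun ω => ((B ω).toNat : ℝ) :=
    (Measurable.of_discrete (f := fun s : Bool => (s.toNat : ℝ))).comp hB
  have hBi : Integrable (fun ω => ((B ω).toNat : ℝ)) D := by
    rw [hind]; exact (integrable_const _).indicator (hB .of_discrete)
  have hBh : Integrable ((fun ω => ((B ω).toNat : ℝ)) * fun ω => h (X ω)) D := by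
    refine hi.norm.mono' (hBm.mul (hh.comp hX)).aestronglyMeasurable (ae_of_all _ fun ω => ?_)
    cases hω : B ω <;> simp [hω]
  have hg : StronglyMeasurable[MeasurableSpace.comap X inferInstance] fun ω => h (X ω) :=
    (hh.comp (comap_measurable X)).stronglyMeasurable
  have h1 := condExp_mul_of_stronglyMeasurable_right hg hBh hBi
  have h2 := condDistrib_ae_eq_condExp (μ := D) hX hB (MeasurableSet.of_discrete (s := {true}))
  rw [← hind] at h2
  calc _ = ∫ ω, (D[(fun ω => ((B ω).toNat : ℝ)) * fun ω => h (X ω) |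
        MeasurableSpace.comap X inferInstance]) ω ∂D := (integral_condExp hX.comap_le).symm
    _ = _ := by
      refine integral_congr_ae ?_
      filter_upwards [h1, h2, hq] with ω h1 h2 h3
      rw [h1, Pi.mul_apply, ← h2, h3]

variable {p : ℕ} {D : Measure (Obs p)} [IsFiniteMeasure D] {θstar : Param p}

/-- In the double logistic model `P(S = 1 | X = x) = σ(β⋆ᵀx) σ(γ⋆ᵀx)`. -/
lemma DoubleLogistic.integral_label_mul (hD : DoubleLogistic D θstar) {h : (Fin p → ℝ) → ℝ}
    (hh : Measurable h) (hi : Integrable (fun z : Obs p => h z.feature) D) :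
    ∫ z : Obs p, (z.label.toNat : ℝ) * h z.feature ∂D =
      ∫ z : Obs p, Real.sigmoid (θstar.1 ⬝ᵥ z.feature) * Real.sigmoid (θstar.2 ⬝ᵥ z.feature) *
        h z.feature ∂D := by
  have hσ : Measurable fun x : Fin p → ℝ => Real.sigmoid (θstar.2 ⬝ᵥ x) :=
    continuous_sigmoid.measurable.comp (measurable_dotProduct_right _)
  have e0 := ae_of_ae_map measurable_feature.aemeasurable hD.negative_unlabelled
  have e1 := ae_of_ae_map measurable_feature.aemeasurable hD.propensity_eq
  have e2 := ae_of_ae_map measurable_feature.aemeasurable hD.posterior_eq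
  -- Conditioning on (X, Y) first replaces S by Y σ(γ⋆ᵀX); conditioning on X then replaces Y by
  -- σ(β⋆ᵀX).
  have s1 := integral_bool_mul_eq (D := D) (X := fun z : Obs p => (z.feature, z.trueClass))
    (B := Obs.label) (q := fun x => (x.2.toNat : ℝ) * Real.sigmoid (θstar.2 ⬝ᵥ x.1))
    (h := fun x => h x.1) (measurable_feature.prodMk measurable_trueClass) measurable_label
    (by
      filter_upwards [e0, e1] with z h0 h1
      cases hz : z.trueClass
      · simpa [labelProb] using h0
      · simpa [propensity, labelProb] using h1) (hh.comp measurable_fst) hi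
  have hi' : Integrable
      (fun z : Obs p => Real.sigmoid (θstar.2 ⬝ᵥ z.feature) * h z.feature) D := by
    refine hi.norm.mono' ((hσ.mul hh).comp measurable_feature).aestronglyMeasurable
      (ae_of_all _ fun z => ?_)
    rw [norm_mul, Real.norm_of_nonneg (Real.sigmoid_nonneg _)]
    exact mul_le_of_le_one_left (norm_nonneg _) (Real.sigmoid_le_one _)
  have s2 := integral_bool_mul_eq (D := D) (q := fun x => Real.sigmoid (θstar.1 ⬝ᵥ x))
    (h := fun x => Real.sigmoid (θstar.2 ⬝ᵥ x) * h x) measurable_feature measurable_trueClass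
    e2 (hσ.mul hh) hi'
  simp only [mul_assoc] at s1 s2 ⊢
  exact s1.trans s2

/-- The Gibbs inequality for two Bernoulli laws with success probabilities `m` and `q`. -/
lemma bernoulli_gibbs {m q : ℝ} (hm0 : 0 < m) (hm1 : m < 1) (hq0 : 0 < q) (hq1 : q < 1) :
    0 ≤ m * (Real.log m - Real.log q) + (1 - m) * (Real.log (1 - m) - Real.log (1 - q)) := by
  have key : ∀ x y : ℝ, 0 < x → 0 < y → x - y ≤ x * (Real.log x - Real.log y) := by
    intro x y hx hy
    have := Real.log_le_sub_one_of_pos (div_pos hy hx)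
    rw [Real.log_div hy.ne' hx.ne'] at this
    have h2 : x * (y / x) = y := by field_simp
    nlinarith
  linarith [key m q hm0 hq0, key (1 - m) (1 - q) (sub_pos.2 hm1) (sub_pos.2 hq1)]

/-- The ground truth minimises the risk. -/
theorem DoubleLogistic.excessRisk_nonneg (hD : DoubleLogistic D θstar)
    (hX : ∀ j, Integrable (fun z : Obs p => z.feature j) D) (θ : Param p) :
    0 ≤ excessRisk D θstar θ := by
  -- The class `true` is a dummy value, as the loss does not depend on Y.
  set d : Bool → (Fin p → ℝ) → ℝ := fun s x =>
    paramLoss θ (x, true, s) - paramLoss θstar (x, true, s) with hd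
  have hdm : ∀ s, Measurable (d s) := fun s =>
    ((measurable_paramLoss θ).comp (measurable_id.prodMk measurable_const)).sub
      ((measurable_paramLoss θstar).comp (measurable_id.prodMk measurable_const))
  have hdi : ∀ s, Integrable (fun z : Obs p => d s z.feature) D := by
    intro s
    refine ((integrable_featureL1 hX).const_mul (Param.l1 (θ - θstar))).mono'
      ((hdm s).comp measurable_feature).aestronglyMeasurable (ae_of_all _ fun z => ?_)
    have := abs_centredLoss_sub_le_l1 θ θstar (z.feature, true, s)
    rwa [centredLoss, centredLoss, sub_sub_sub_cancel_right] at this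
  have hdi' : Integrable (fun z : Obs p => d true z.feature - d false z.feature) D :=
    (hdi true).sub (hdi false)
  have hmi : Integrable (fun z : Obs p => Real.sigmoid (θstar.1 ⬝ᵥ z.feature) *
      Real.sigmoid (θstar.2 ⬝ᵥ z.feature) * (d true z.feature - d false z.feature)) D := by
    have hσ : ∀ a : Fin p → ℝ, Measurable fun x : Fin p → ℝ => Real.sigmoid (a ⬝ᵥ x) := fun a =>
      continuous_sigmoid.measurable.comp (measurable_dotProduct_right _)
    refine hdi'.norm.mono' ((((hσ _).mul (hσ _)).mul
      ((hdm true).sub (hdm false))).comp measurable_feature).aestronglyMeasurable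
      (ae_of_all _ fun z => ?_)
    rw [norm_mul, Real.norm_of_nonneg (sigmoid_mul_sigmoid_pos _ _).le]
    exact mul_le_of_le_one_left (norm_nonneg _) (sigmoid_mul_sigmoid_lt_one _ _).le
  have hsi : Integrable (fun z : Obs p =>
      (z.label.toNat : ℝ) * (d true z.feature - d false z.feature)) D := by
    refine hdi'.norm.mono' (((Measurable.of_discrete
      (f := fun s : Bool => (s.toNat : ℝ))).comp measurable_label).mul
      (((hdm true).sub (hdm false)).comp measurable_feature)).aestronglyMeasurable
      (ae_of_all _ fun z => ?_)
    cases z.label <;> simp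
  have hsplit : ∀ z : Obs p, paramLoss θ z - paramLoss θstar z =
      d false z.feature + (z.label.toNat : ℝ) * (d true z.feature - d false z.feature) := by
    rintro ⟨x, y, s⟩
    cases s <;> simp [hd, paramLoss, Obs.feature, Obs.label]
  rw [excessRisk, risk, risk,
    ← integral_sub (integrable_paramLoss hX θ) (integrable_paramLoss hX θstar),
    integral_congr_ae (ae_of_all _ hsplit), integral_add (hdi false) hsi,
    hD.integral_label_mul (h := fun x => d true x - d false x) ((hdm true).sub (hdm false)) hdi',
    ← integral_add (hdi false) hmi]
  -- After conditioning, the integrand is the divergence between the Bernoulli laws of S given X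
  -- under θ⋆ and under θ.
  refine integral_nonneg fun z => ?_
  have := bernoulli_gibbs
    (sigmoid_mul_sigmoid_pos (θstar.1 ⬝ᵥ z.feature) (θstar.2 ⬝ᵥ z.feature))
    (sigmoid_mul_sigmoid_lt_one _ _)
    (sigmoid_mul_sigmoid_pos (θ.1 ⬝ᵥ z.feature) (θ.2 ⬝ᵥ z.feature)) (sigmoid_mul_sigmoid_lt_one _ _)
  refine this.trans_eq ?_
  simp only [hd, paramLoss, Obs.feature, Obs.label, loss_true, loss_false]
  ring

lemma excessRisk_swap (D : Measure (Obs p)) (θstar θ : Param p) :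
    excessRisk D θstar (θ.2, θ.1) = excessRisk D θstar θ := by
  simp only [excessRisk, risk, paramLoss, loss_comm (θ.2 ⬝ᵥ _)]

lemma excessRisk_reorder (D : Measure (Obs p)) (θstar θ : Param p) :
    excessRisk D θstar (reorder θ) = excessRisk D θstar θ := by
  unfold reorder
  split_ifs
  · rfl
  · exact excessRisk_swap D θstar θ

end ExcessRisk

/-! ### Tail bounds uniform over the ball -/

section UniformDeviation

variable {p n : ℕ} {D : Measure (Obs p)} [IsProbabilityMeasure D] {μ : ℝ≥0}

/-- The one-sided (`s = ±`) deviation of the centred empirical loss from its mean, times `n`. -/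
noncomputable def deviation (D : Measure (Obs p)) (s : Bool) (z : Fin n → Obs p) (θ : Param p) :
    ℝ :=
  ∑ i, (boolSign s * centredLoss θ (z i) - ∫ x, boolSign s * centredLoss θ x ∂D)

omit [IsProbabilityMeasure D] in
lemma continuous_deviation (hX : ∀ j, Integrable (fun z : Obs p => z.feature j) D) (s : Bool)
    (z : Fin n → Obs p) : Continuous (deviation D s z) := by
  refine continuous_finsetSum _ fun i _ => ((continuous_centredLoss (z i)).const_mul _).sub ?_
  simp only [integral_const_mul]
  exact (continuous_integral_centredLoss hX).const_mul _

/-- Uniform tail bound for the deviation over the `ℓ₁` ball. -/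
theorem measure_exists_deviation_le [NeZero p] (hD : SubGaussianFeatures D μ) {w : ℝ} (hw : 0 ≤ w)
    (s : Bool) {r δ : ℝ} (hr : 0 < r) (hδ : 0 < δ) :
    (Measure.pi fun _ : Fin n => D) {z | ∃ θ ∈ l1Ball p w, δ < deviation D s z θ} ≤
      ENNReal.ofReal (4 * w * (Real.log (4 * p) / r + r * (n * μ ^ 2) / 2) / δ) := by
  have hX := hD.integrable
  have h0 : (0 : Param p) ∈ l1Ball p w := by simpa [l1Ball, Param.l1, l1] using hw
  have : Nonempty (l1Ball p w) := ⟨⟨0, h0⟩⟩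
  -- A dense sequence suffices, as the deviation is continuous in θ and the event is a strict
  -- inequality. The prepended zero parameter has zero deviation, so the maxima `M N` are
  -- nonnegative, as Markov's inequality requires.
  set u : ℕ → Param p := fun k => Nat.casesOn k 0 fun k => TopologicalSpace.denseSeq (l1Ball p w) k
  have hu : ∀ k, u k ∈ l1Ball p w := by
    rintro (_ | k)
    · exact h0
    · exact (TopologicalSpace.denseSeq (l1Ball p w) k).2
  set M : ℕ → (Fin n → Obs p) → ℝ := fun N z => ⨆ t : Fin (N + 1), deviation D s z (u t) with hM
  have hsub : {z : Fin n → Obs p | ∃ θ ∈ l1Ball p w, δ < deviation D s z θ} ⊆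
      ⋃ N, {z | δ ≤ M N z} := by
    rintro z ⟨θ, hθ, hz⟩
    have hopen : IsOpen {θ : l1Ball p w | δ < deviation D s z θ} :=
      isOpen_lt continuous_const ((continuous_deviation hX s z).comp continuous_subtype_val)
    obtain ⟨k, hk⟩ := (TopologicalSpace.denseRange_denseSeq (l1Ball p w)).exists_mem_open hopen
      ⟨⟨θ, hθ⟩, hz⟩
    refine Set.mem_iUnion.2 ⟨k + 1, ?_⟩
    exact (Set.mem_ofPred.1 hk).le.trans
      (le_ciSup_of_finite (fun t : Fin (k + 1 + 1) => deviation D s z (u t)) (Fin.last (k + 1)))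
  have hmono : Monotone fun N => {z : Fin n → Obs p | δ ≤ M N z} := by
    intro N N' h z hz
    refine le_trans (Set.mem_ofPred.1 hz) (ciSup_le fun t => ?_)
    exact le_ciSup_of_finite (fun t : Fin (N' + 1) => deviation D s z (u t))
      ⟨t, t.2.trans_le (by omega)⟩
  refine (measure_mono hsub).trans ?_
  rw [hmono.measure_iUnion]
  refine iSup_le fun N => ?_
  have hint : Integrable (M N) (Measure.pi fun _ : Fin n => D) := by
    refine integrable_ciSup_of_finite fun t => ?_
    have hc := (integrable_centredLoss hX (u t)).const_mul (boolSign s)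
    refine integrable_finsetSum _ fun i _ => Integrable.sub ?_ (integrable_const _)
    exact (measurePreserving_eval (fun _ : Fin n => D) i).integrable_comp_of_integrable hc
  have hnonneg : ∀ z, 0 ≤ M N z := fun z => by
    have := le_ciSup_of_finite (fun t : Fin (N + 1) => deviation D s z (u t)) 0
    refine le_trans ?_ this
    simp [u, deviation]
  have hmarkov := mul_meas_ge_le_integral_of_nonneg (ae_of_all _ hnonneg) hint δ
  have hexp : ∫ z, M N z ∂(Measure.pi fun _ : Fin n => D) ≤ _ :=
    integral_ciSup_deviation_le (n := n) hD (θ := fun t : Fin (N + 1) => u t) (fun t => hu t) s hr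
  rw [← ofReal_measureReal]
  refine ENNReal.ofReal_le_ofReal ((le_div_iff₀ hδ).2 ?_)
  rw [mul_comm]
  exact hmarkov.trans hexp

/-- The right side minus the left equals n(Q_n(θ⋆) - Q_n(θ)), which minimality makes nonnegative;
the losses at zero cancel. -/
lemma mul_excessRisk_le_deviation (hX : ∀ j, Integrable (fun z : Obs p => z.feature j) D)
    (hn : 0 < n) {w : ℝ} {θstar θ : Param p} (hstar : θstar ∈ l1Ball p w) {z : Fin n → Obs p}
    (hθ : IsBallMinimiser z w θ) :
    n * excessRisk D θstar θ ≤ deviation D false z θ + deviation D true z θstar := by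
  have hle : empRisk z θ ≤ empRisk z θstar := hθ.2 hstar
  have hn' : (0 : ℝ) < n := by exact_mod_cast hn
  have hsum : ∑ i, paramLoss θ (z i) ≤ ∑ i, paramLoss θstar (z i) :=
    le_of_mul_le_mul_left hle (by positivity)
  simp only [deviation, integral_const_mul, integral_centredLoss hX]
  simp only [boolSign_true, boolSign_false, Finset.sum_sub_distrib, centredLoss, excessRisk, ← Finset.mul_sum,
    Finset.sum_const, Finset.card_univ, Fintype.card_fin, nsmul_eq_mul]
  linarith

/-- Nonasymptotic tail bound for the excess risk of empirical risk minimisers. -/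
theorem measure_exists_excessRisk_le [NeZero p] (hD : SubGaussianFeatures D μ) (hn : 0 < n) {w : ℝ}
    {θstar : Param p} (hstar : θstar ∈ l1Ball p w) {r ε : ℝ} (hr : 0 < r) (hε : 0 < ε) :
    (Measure.pi fun _ : Fin n => D)
        {z | ∃ θ, IsBallMinimiser z w θ ∧ ε ≤ excessRisk D θstar θ} ≤
      2 * ENNReal.ofReal (4 * w * (Real.log (4 * p) / r + r * (n * μ ^ 2) / 2) / (n * ε / 4)) := by
  have hw : 0 ≤ w := (add_nonneg (l1_nonneg _) (l1_nonneg _)).trans hstar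
  have hn' : (0 : ℝ) < n := by exact_mod_cast hn
  have hδ : 0 < n * ε / 4 := by positivity
  rw [two_mul]
  refine le_trans (measure_mono ?_) ((measure_union_le _ _).trans
    (add_le_add (measure_exists_deviation_le (n := n) hD hw false hr hδ)
      (measure_exists_deviation_le (n := n) hD hw true hr hδ)))
  rintro z ⟨θ, hθ, hz⟩
  have h1 := mul_excessRisk_le_deviation hD.integrable hn hstar hθ
  have h2 : n * ε ≤ n * excessRisk D θstar θ := by gcongr
  -- If the first deviation is at most nε/4, the second is at least 3nε/4, which leaves room for the
  -- strict inequality.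
  by_cases h3 : n * ε / 4 < deviation D false z θ
  · exact Or.inl ⟨θ, hθ.1, h3⟩
  · exact Or.inr ⟨θstar, hstar, by linarith⟩

end UniformDeviation

/-! ### Rates as n tends to infinity -/

section Asymptotics

variable {p : ℕ → ℕ}

lemma log_natCast_pos {m : ℕ} (hm : 2 ≤ m) : 0 < Real.log m :=
  Real.log_pos (by exact_mod_cast hm)

lemma tendsto_radius_atTop (hp : ∀ n, 2 ≤ p n)
    (hlog : (fun n : ℕ => Real.log (p n : ℝ)) =o[atTop] (fun n : ℕ => (n : ℝ)))
    {C η : ℝ} (hC : 0 < C) (hη : η < 1 / 2) :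
    Tendsto (fun n => radius C η n (p n)) atTop atTop := by
  have h1 : Tendsto (fun n : ℕ => (n : ℝ) / Real.log (p n)) atTop atTop := by
    have h0 : Tendsto (fun n : ℕ => Real.log (p n) / (n : ℝ)) atTop (𝓝[>] 0) := by
      refine tendsto_nhdsWithin_iff.2 ⟨hlog.tendsto_div_nhds_zero, ?_⟩
      filter_upwards [eventually_gt_atTop 0] with n hn
      exact div_pos (log_natCast_pos (hp n)) (by exact_mod_cast hn)
    refine h0.inv_tendsto_nhdsGT_zero.congr fun n => ?_
    simp
  exact ((tendsto_rpow_atTop (by linarith)).comp h1).const_mul_atTop hC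

lemma log_four_mul_le {m : ℕ} (hm : 2 ≤ m) : Real.log (4 * m) ≤ 3 * Real.log m := by
  have h2 : (2 : ℝ) ≤ m := by exact_mod_cast hm
  rw [Real.log_mul (by norm_num) (by positivity), show (4 : ℝ) = 2 ^ 2 by norm_num, Real.log_pow]
  have := Real.log_le_log (by norm_num) h2
  push_cast
  linarith

/-- The choice r = √ρ with ρ = log m / n gives both terms of the maximal inequality the order n√ρ.
As the radius is Cρ^(η - 1/2), its product with √ρ is Cρ^η. -/
lemma tail_bound_le {m n : ℕ} (hm : 2 ≤ m) (hn : 0 < n) {C η ε : ℝ} (hC : 0 < C) (hε : 0 < ε)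
    (μ : ℝ≥0) {ρ : ℝ} (hρ : ρ = Real.log m / n) :
    4 * radius C η n m * (Real.log (4 * m) / √ρ + √ρ * (n * μ ^ 2) / 2) / (n * ε / 4) ≤
      16 * C * (3 + μ ^ 2 / 2) / ε * ρ ^ η := by
  have hn' : (0 : ℝ) < n := by exact_mod_cast hn
  have hl := log_natCast_pos hm
  have hρ0 : 0 < ρ := hρ ▸ div_pos hl hn'
  have hs : 0 < √ρ := Real.sqrt_pos.2 hρ0
  have hlog : Real.log m = ρ * n := by rw [hρ]; field_simp
  have hrad : radius C η n m * √ρ = C * ρ ^ η := by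
    rw [radius, hlog, show (n : ℝ) / (ρ * n) = ρ⁻¹ by field_simp, Real.sqrt_eq_rpow,
      Real.inv_rpow hρ0.le, ← Real.rpow_neg hρ0.le, mul_assoc, ← Real.rpow_add hρ0]
    ring_nf
  have hradius : 0 ≤ radius C η n m := by
    unfold radius; positivity
  have h1 : Real.log (4 * m) / √ρ ≤ 3 * n * √ρ := by
    rw [div_le_iff₀ hs, mul_assoc, Real.mul_self_sqrt hρ0.le]
    linarith [log_four_mul_le hm]
  calc _ ≤ 4 * radius C η n m * (3 * n * √ρ + √ρ * (n * μ ^ 2) / 2) / (n * ε / 4) := by gcongr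
    _ = 16 * (radius C η n m * √ρ) * (3 + μ ^ 2 / 2) / ε := by field_simp; ring
    _ = _ := by rw [hrad]; ring

end Asymptotics

end PULearning

theorem theorem2
    (p : ℕ → ℕ) (hp : ∀ n, 2 ≤ p n)
    (hlog : (fun n : ℕ => Real.log (p n : ℝ)) =o[atTop] (fun n : ℕ => (n : ℝ)))
    (C η : ℝ) (hC : 0 < C) (hη0 : 0 < η) (hη : η < 1 / 2)
    (D : (n : ℕ) → Measure (PULearning.Obs (p n))) [∀ n, IsProbabilityMeasure (D n)]
    (θstar : (n : ℕ) → PULearning.Param (p n))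
    (hmodel : ∀ n, PULearning.DoubleLogistic (D n) (θstar n))
    (hbound : ∃ B : ℝ, ∀ n, PULearning.Param.l1 (θstar n) ≤ B)
    (hpos : ∀ n, (PULearning.secondMoment (D n)).PosDef)
    (μ : ℝ≥0) (hμ : 0 < μ)
    (hsub : ∀ n, PULearning.SubGaussianFeatures (D n) μ)
    {Ω : ℕ → Type*} [∀ n, MeasurableSpace (Ω n)]
    (P : (n : ℕ) → Measure (Ω n)) [∀ n, IsProbabilityMeasure (P n)]
    (Z : (n : ℕ) → Fin n → Ω n → PULearning.Obs (p n))
    (hlaw : ∀ n i, HasLaw (Z n i) (D n) (P n))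
    (hindep : ∀ n, iIndepFun (Z n) (P n))
    (θtilde : (n : ℕ) → Ω n → PULearning.Param (p n))
    (hmin : ∀ n, ∀ᵐ ω ∂(P n), PULearning.IsBallMinimiser (fun i => Z n i ω)
      (PULearning.radius C η n (p n)) (θtilde n ω)) :
    ∀ ε : ℝ, 0 < ε →
      Tendsto (fun n => P n {ω | ε ≤ |PULearning.excessRisk (D n) (θstar n) (θtilde n ω)|})
        atTop (𝓝 0) ∧
      Tendsto (fun n => P n {ω | ε ≤ |PULearning.excessRisk (D n) (θstar n)
          (PULearning.reorder (θtilde n ω))|})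
        atTop (𝓝 0) := by
  intro ε hε
  simp only [PULearning.excessRisk_reorder, and_self]
  obtain ⟨B, hB⟩ := hbound
  set K : ℝ := 16 * C * (3 + μ ^ 2 / 2) / ε
  have hlim : Tendsto (fun n : ℕ => 2 * ENNReal.ofReal (K * (Real.log (p n) / n) ^ η))
      atTop (𝓝 0) := by
    have h1 : Tendsto (fun n : ℕ => K * (Real.log (p n) / n) ^ η) atTop (𝓝 0) := by
      have := (hlog.tendsto_div_nhds_zero.rpow_const (Or.inr hη0.le)).const_mul K
      simpa [Real.zero_rpow hη0.ne'] using this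
    have h2 := ENNReal.Tendsto.const_mul (a := 2) (ENNReal.tendsto_ofReal h1)
      (Or.inr ENNReal.ofNat_ne_top)
    simpa using h2
  refine tendsto_of_tendsto_of_tendsto_of_le_of_le' tendsto_const_nhds hlim
    (Eventually.of_forall fun _ => zero_le) ?_
  filter_upwards [eventually_gt_atTop 0,
    (PULearning.tendsto_radius_atTop hp hlog hC hη).eventually_ge_atTop B] with n hn hBn
  have : NeZero (p n) := ⟨by have := hp n; omega⟩
  have hstar : θstar n ∈ PULearning.l1Ball (p n) (PULearning.radius C η n (p n)) :=
    (hB n).trans hBn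
  have hρ : 0 < Real.log (p n) / n :=
    div_pos (PULearning.log_natCast_pos (hp n)) (by exact_mod_cast hn)
  have hmeas : ∀ i, AEMeasurable (Z n i) (P n) := fun i => (hlaw n i).aemeasurable
  have hmap : (P n).map (fun ω i => Z n i ω) = Measure.pi fun _ => D n := by
    rw [(iIndepFun_iff_map_fun_eq_pi_map hmeas).1 (hindep n)]
    simp only [(hlaw n _).map_eq]
  set A : Set (Fin n → PULearning.Obs (p n)) := {z | ∃ θ, PULearning.IsBallMinimiser z
    (PULearning.radius C η n (p n)) θ ∧ ε ≤ PULearning.excessRisk (D n) (θstar n) θ}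
  calc P n {ω | ε ≤ |PULearning.excessRisk (D n) (θstar n) (θtilde n ω)|}
      ≤ P n ((fun ω i => Z n i ω) ⁻¹' A) := by
        refine measure_mono_ae ?_
        filter_upwards [hmin n] with ω hω hε'
        refine ⟨θtilde n ω, hω, ?_⟩
        rwa [← abs_of_nonneg ((hmodel n).excessRisk_nonneg (hsub n).integrable (θtilde n ω))]
    -- This inequality holds for arbitrary sets, so neither `A` nor the choice of minimiser has to
    -- be measurable.
    _ ≤ (P n).map (fun ω i => Z n i ω) A :=
        Measure.le_map_apply (aemeasurable_pi_lambda _ hmeas) A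
    _ ≤ _ := by
        rw [hmap]
        refine (PULearning.measure_exists_excessRisk_le (hsub n) hn hstar
          (Real.sqrt_pos.2 hρ) hε).trans ?_
        gcongr
        exact PULearning.tail_bound_le (hp n) hn hC hε μ rfl
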